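/- **Setting (profit maximization with production costs).** A seller can produce $m\ge 1$ items. The cost of producing $\mu\in\mathbb R_+^m$ is $g(\mu)$, where $g:\mathbb R_+^m\to\mathbb R_+$ is monotone and convex. Buyers $i=1,\dots,n$ arrive online ($n$ is not known in advance). Buyer $i$ has a family $\mathcal S_i\subseteq 2^{[m]}$ of bundles and a valuation $v_i:\mathcal S_i\to\mathbb R_+$. On the arrival of buyer $i$ the seller irrevocably allocates to him one bundle $T_i\in\mathcal S_i$, for the payment $v_i(T_i)$, or nothing. The profit is $\sum_i v_i(T_i)-g\big(\sum_i\chi_{T_i}\big)$, the sums running over the buyers that are served. The fractional problem is $$\max\ \sum_{i}\sum_{T\in\mathcal S_i}v_i(T)\,y_{iT}-g(\mu)\quad\text{s.t.}\quad \sum_{T\in\mathcal S_i}y_{iT}\le 1\ \ \forall i,\qquad \sum_i\sum_{T\in\mathcal S_i}\mathbf 1_{j\in T}\,y_{iT}\le\mu_j\ \ \forall j,\qquad y,\mu\ge 0 .$$ A (monotone) fractional online algorithm fixes $(y_{iT})_{T\in\mathcal S_i}$ irrevocably when buyer $i$ arrives and maintains non-decreasing production levels $\mu$ so that $(y,\mu)$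 is always feasible. It is $\alpha$-competitive ($\alpha>0$) on a class of buyer sequences if on each of them its objective value is at least $1/\alpha$ times the offline optimum of the fractional problem. **Assumptions on $g$.** (1) $g^\star(x)=\sup_{\mu\ge 0}\{x^{T}\mu-g(\mu)\}$ is a finite nonnegative function on $\mathbb R_+^m$ that is monotone, convex, continuous and differentiable, with $\nabla g^\star(x)\ge\nabla g^\star(x')$ whenever $x\ge x'\ge 0$. (2) There is a constant $\beta>1$ with $g(a\mu)\le a^{\beta}g(\mu)$ for all $0<a<1$ and $\mu\in\mathbb R_+^m$. **Theorem.** There is an absolute constant $C>0$ such that the following holds for all $m\ge 1$, all $g$ and $\beta$ as above, all $\epsilon\in(0,1)$ and every fractional online algorithm. Put $L=C\,\frac{\log m}{\epsilon^2}$. There is a randomized online algorithm for the integral problem such that, whenever the fractional online algorithm is $\alpha$-competitive on a class of buyer sequences, on every sequence of this class the expected profit of the randomized algorithm is at least $$(1+\epsilon)^{-2-\frac{2}{\beta-1}}\cdot\frac{\mathrm{OPT}}{\alpha}-\frac{\mathrm{OPT}}{m\,\alpha}-g(L\cdot\mathbf 1).$$ This holds both with $\mathrm{OPT}$ the offline optimal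 profit of the integral problem and with $\mathrm{OPT}$ the offline optimum of the fractional problem. -/

import Mathlib

open Set Finset BigOperators

noncomputable section

/-- A buyer: the family of bundles (sets of items) in which he is interested, and a nonnegative
valuation of these bundles. -/
structure Buyer (m : ℕ) where
  bundles : Finset (Finset (Fin m))
  value : Finset (Fin m) → ℝ
  value_nonneg : ∀ T ∈ bundles, 0 ≤ value T

/-- A decision for one buyer: `some T` allocates the bundle `T`, `none` skips the buyer. -/
abbrev Decision (m : ℕ) := Option (Finset (Fin m))

/-- An admissible decision allocates a bundle from the buyer's own family, or nothing. -/
def Buyer.Admissible {m : ℕ} (b : Buyer m) (D : Decision m) : Prop :=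
  ∀ T, D = some T → T ∈ b.bundles

/-- The payment of buyer `b` under decision `D`. -/
def Buyer.payment {m : ℕ} (b : Buyer m) (D : Decision m) : ℝ :=
  D.elim 0 b.value

/-- The characteristic vector of the allocated bundle. -/
def Decision.demand {m : ℕ} (D : Decision m) (j : Fin m) : ℝ :=
  D.elim 0 (fun T => if j ∈ T then 1 else 0)

/-- The profit `∑ i, v_i(T_i) - g (∑ i, χ_{T_i})` of an integral allocation, which is given as
the list of the buyers together with the decisions made for them. -/
def profit {m : ℕ} (g : (Fin m → ℝ) → ℝ) (h : List (Buyer m × Decision m)) : ℝ :=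
  (h.map fun p => p.1.payment p.2).sum - g (fun j => (h.map fun p => Decision.demand p.2 j).sum)

/-- The offline optimal (integral) profit for the sequence `σ` of buyers. -/
def offlineOpt {m : ℕ} (g : (Fin m → ℝ) → ℝ) (σ : List (Buyer m)) : ℝ :=
  sSup {r | ∃ h : List (Buyer m × Decision m),
    h.map Prod.fst = σ ∧ (∀ p ∈ h, p.1.Admissible p.2) ∧ r = profit g h}

/-- Feasibility of `(y, μ)` for the convex program
`max ∑ i, ∑ T ∈ S_i, v_i(T) y_{iT} - g(μ)` subject to `∑ T ∈ S_i, y_{iT} ≤ 1` for every buyer `i`,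
`∑ i, ∑ T ∈ S_i, 1_{j ∈ T} y_{iT} ≤ μ_j` for every item `j`, and `y, μ ≥ 0`. -/
structure FracFeasible {m : ℕ} (σ : List (Buyer m))
    (y : Fin σ.length → Finset (Fin m) → ℝ) (μ : Fin m → ℝ) : Prop where
  y_nonneg : ∀ i, ∀ T ∈ (σ.get i).bundles, 0 ≤ y i T
  μ_nonneg : 0 ≤ μ
  sum_le_one : ∀ i, ∑ T ∈ (σ.get i).bundles, y i T ≤ 1
  demand_le : ∀ j, ∑ i, ∑ T ∈ (σ.get i).bundles, (if j ∈ T then y i T else 0) ≤ μ j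

/-- The objective of the convex program. -/
def fracProfit {m : ℕ} (g : (Fin m → ℝ) → ℝ) (σ : List (Buyer m))
    (y : Fin σ.length → Finset (Fin m) → ℝ) (μ : Fin m → ℝ) : ℝ :=
  ∑ i, ∑ T ∈ (σ.get i).bundles, (σ.get i).value T * y i T - g μ

/-- The offline optimum of the convex program for the sequence `σ` of buyers. -/
def offlineFracOpt {m : ℕ} (g : (Fin m → ℝ) → ℝ) (σ : List (Buyer m)) : ℝ :=
  sSup {r | ∃ y μ, FracFeasible σ y μ ∧ r = fracProfit g σ y μ}

/-- A deterministic monotone online algorithm for the convex program. When buyer `b` arrives after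
the buyers `σ`, it irrevocably fixes the fractional allocation `alloc σ b` of `b`; the production
levels `prod` never decrease. At every time the current solution is feasible. -/
structure FracAlg (m : ℕ) where
  alloc : List (Buyer m) → Buyer m → Finset (Fin m) → ℝ
  prod : List (Buyer m) → Fin m → ℝ
  prod_mono : ∀ σ b, prod σ ≤ prod (σ ++ [b])
  feasible : ∀ σ, FracFeasible σ (fun i => alloc (σ.take i) (σ.get i)) (prod σ)

/-- The objective value reached by a fractional online algorithm on the sequence `σ`. -/
def FracAlg.profit {m : ℕ} (A : FracAlg m) (g : (Fin m → ℝ) → ℝ) (σ : List (Buyer m)) : ℝ :=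
  fracProfit g σ (fun i => A.alloc (σ.take i) (σ.get i)) (A.prod σ)

/-- `A` is `α`-competitive on the class `I` of buyer sequences. -/
def FracAlg.IsCompetitive {m : ℕ} (A : FracAlg m) (g : (Fin m → ℝ) → ℝ)
    (I : Set (List (Buyer m))) (α : ℝ) : Prop :=
  ∀ σ ∈ I, offlineFracOpt g σ / α ≤ A.profit g σ

/-- A randomized online algorithm for the integral problem. When a buyer arrives, it draws an
admissible decision from a distribution that depends on the earlier buyers, on the decisions made
for them, and on the arriving buyer. -/
structure RandAlg (m : ℕ) where
  decide : List (Buyer m × Decision m) → Buyer m → PMF (Decision m)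
  admissible : ∀ h b, ∀ D ∈ (decide h b).support, b.Admissible D

/-- The distribution of the final allocation, when the allocation `h` has been made already and the
buyers in the second argument are still to arrive. -/
def RandAlg.run {m : ℕ} (R : RandAlg m) :
    List (Buyer m × Decision m) → List (Buyer m) → PMF (List (Buyer m × Decision m))
  | h, [] => PMF.pure h
  | h, b :: σ => (R.decide h b).bind fun D => R.run (h ++ [(b, D)]) σ

/-- The expected profit on the sequence `σ`; only finitely many allocations have positive
probability. -/
def RandAlg.expectedProfit {m : ℕ} (R : RandAlg m) (g : (Fin m → ℝ) → ℝ)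
    (σ : List (Buyer m)) : ℝ :=
  ∑' h, (R.run [] σ h).toReal * _root_.profit g h

/-- The Fenchel conjugate `g⋆(x) = sup_μ (xᵀμ - g(μ))` of a function `g` on the nonnegative
orthant. -/
def fenchelConj {m : ℕ} (g : (Fin m → ℝ) → ℝ) (x : Fin m → ℝ) : ℝ :=
  sSup ((fun μ => x ⬝ᵥ μ - g μ) '' Ici 0)

/-- A production cost function: nonnegative, monotone and convex on the nonnegative orthant. -/
structure IsProductionCost {m : ℕ} (g : (Fin m → ℝ) → ℝ) : Prop where
  nonneg : ∀ μ, 0 ≤ μ → 0 ≤ g μ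
  mono : MonotoneOn g (Ici 0)
  convex : ConvexOn ℝ (Ici 0) g

/-- The `j`-th partial derivative of `f` on the nonnegative orthant (one-sided on the boundary). -/
def orthantGrad {m : ℕ} (f : (Fin m → ℝ) → ℝ) (x : Fin m → ℝ) (j : Fin m) : ℝ :=
  fderivWithin ℝ f (Ici 0) x (Pi.single j 1)

/-- `g⋆` is a finite nonnegative function on the nonnegative orthant that is monotone, convex,
continuous and differentiable, with monotone gradient. -/
structure HasMonotoneGradientConj {m : ℕ} (g : (Fin m → ℝ) → ℝ) : Prop where
  finite : ∀ x, 0 ≤ x → BddAbove ((fun μ => x ⬝ᵥ μ - g μ) '' Ici 0)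
  nonneg : ∀ x, 0 ≤ x → 0 ≤ fenchelConj g x
  mono : MonotoneOn (fenchelConj g) (Ici 0)
  convex : ConvexOn ℝ (Ici 0) (fenchelConj g)
  continuous : ContinuousOn (fenchelConj g) (Ici 0)
  differentiable : DifferentiableOn ℝ (fenchelConj g) (Ici 0)
  grad_mono : ∀ x x', 0 ≤ x' → x' ≤ x →
    orthantGrad (fenchelConj g) x' ≤ orthantGrad (fenchelConj g) x

/-- `g(aμ) ≤ a^β g(μ)` for all `0 < a < 1` and `μ ≥ 0`. -/
def ScalesWith {m : ℕ} (g : (Fin m → ℝ) → ℝ) (β : ℝ) : Prop :=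
  ∀ a : ℝ, 0 < a → a < 1 → ∀ μ : Fin m → ℝ, 0 ≤ μ → g (a • μ) ≤ a ^ β * g μ

end

/-! ### Sums along a sequence of buyers -/

/-! Scale the fractional solution `(y, μ)` by a factor `s` and round each buyer with these
probabilities, skipping any bundle that would push the demand above `thr = (1+ε) s μ + a L`. The
demand then stays below `thr` on every run, so the cost is at most `g thr`. With `s = (1-a) κ
(1+ε)`, where `κ = (1+ε)^(-2-2/(β-1))`, the threshold is the convex combination `(1-a) (c μ) + a L`
with `c^β = κ`; convexity and scaling bound its cost by `(1-a) κ g(μ) + a g(L)`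
(`FracAlg.exists_round_profit`). Payments are lost only through skips. The skipping rule makes
decisions dependent, but it only lowers conditional probabilities, so the Chernoff bound on the
moment generating function survives (`FracAlg.expect_exp_totalDemand_le`). A union bound over the
items makes the loss a fraction `δ` at most (`FracAlg.le_expect_totalPayment`), and `failure_le`
gives `δ ≤ min (1/m) (ε/(1+ε))`. Since `a` is the maximum of the same two numbers, `(1-a)(1-δ) ≥
(1-1/m)/(1+ε)`. Value and cost thus both compare with the factor `κ (1-1/m)`, and competitiveness
finishes the proof. -/

theorem sum_take_get_append {α M : Type*} [AddCommMonoid M] (F : List α → α → M)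
    (σ : List α) (b : α) :
    ∑ i : Fin (σ ++ [b]).length, F ((σ ++ [b]).take i) ((σ ++ [b]).get i) =
      (∑ i : Fin σ.length, F (σ.take i) (σ.get i)) + F σ b := by
  have hlen : (σ ++ [b]).length = σ.length + 1 := by simp
  rw [← (finCongr hlen.symm).sum_comp, Fin.sum_univ_castSucc]
  congr 1
  · refine Finset.sum_congr rfl fun i _ => ?_
    have hi : (i : ℕ) < σ.length := i.2
    simp [List.getElem_append_left hi, List.take_append_of_le_length hi.le]
  · simp

/-! ### Expectations over the runs of a randomized algorithm -/

/-- The expected value of `f` at the final allocation, computed one buyer at a time. -/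
noncomputable def RandAlg.expect {m : ℕ} (R : RandAlg m)
    (f : List (Buyer m × Decision m) → ℝ) : List (Buyer m × Decision m) → List (Buyer m) → ℝ
  | h, [] => f h
  | h, b :: σ => ∑ D, (R.decide h b D).toReal * R.expect f (h ++ [(b, D)]) σ

theorem RandAlg.finite_support_run {m : ℕ} (R : RandAlg m) (σ : List (Buyer m)) :
    ∀ h, (R.run h σ).support.Finite := by
  induction σ with
  | nil => intro h; simp [RandAlg.run]
  | cons b σ ih =>
    intro h
    rw [RandAlg.run, PMF.support_bind]
    exact (Set.toFinite _).biUnion fun D _ => ih _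

/-- Finite support makes every series summable, so sums can be exchanged; from here on only the
finite recursion `expect` is needed. -/
theorem RandAlg.tsum_run {m : ℕ} (R : RandAlg m) (f : List (Buyer m × Decision m) → ℝ)
    (σ : List (Buyer m)) :
    ∀ h, ∑' h', (R.run h σ h').toReal * f h' = R.expect f h σ := by
  induction σ with
  | nil =>
    intro h
    rw [RandAlg.run, RandAlg.expect, tsum_eq_single h]
    · simp
    · intro h' hh
      simp [PMF.pure_apply, hh]
  | cons b σ ih =>
    intro h
    have hrun : ∀ h', (R.run h (b :: σ) h').toReal * f h' =
        ∑ D, (R.decide h b D).toReal * ((R.run (h ++ [(b, D)]) σ h').toReal * f h') := by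
      intro h'
      rw [RandAlg.run, PMF.bind_apply, tsum_fintype, ENNReal.toReal_sum, Finset.sum_mul]
      · exact Finset.sum_congr rfl fun D _ => by rw [ENNReal.toReal_mul, mul_assoc]
      · exact fun D _ => ENNReal.mul_ne_top (PMF.apply_ne_top _ _) (PMF.apply_ne_top _ _)
    rw [RandAlg.expect, tsum_congr hrun, Summable.tsum_finsetSum]
    · exact Finset.sum_congr rfl fun D _ => by rw [tsum_mul_left, ih]
    · intro D _
      refine Summable.mul_left _ (summable_of_hasFiniteSupport ?_)
      refine (R.finite_support_run σ (h ++ [(b, D)])).subset fun h' hh' => ?_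
      rw [PMF.mem_support_iff]
      intro h0
      simp [h0] at hh'

/-- `expect` peels off the first buyer, whereas the probabilistic estimates induct on the last one,
conditioning on the history before him. -/
theorem RandAlg.expect_append {m : ℕ} (R : RandAlg m) (f : List (Buyer m × Decision m) → ℝ)
    (b : Buyer m) (σ : List (Buyer m)) :
    ∀ h, R.expect f h (σ ++ [b]) =
      R.expect (fun h' => ∑ D, (R.decide h' b D).toReal * f (h' ++ [(b, D)])) h σ := by
  induction σ with
  | nil => intro h; simp [RandAlg.expect]
  | cons c σ ih => intro h; simp only [List.cons_append, RandAlg.expect, ih]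

theorem PMF.sum_toReal_eq_one {α : Type*} [Fintype α] (p : PMF α) :
    ∑ a, (p a).toReal = 1 := by
  rw [← ENNReal.toReal_sum fun a _ => p.apply_ne_top a, ← tsum_fintype (L := .unconditional α),
    p.tsum_coe, ENNReal.toReal_one]

/-- `P` is an invariant of all runs of positive probability, so the comparison is only needed on
histories that satisfy it and involve the right buyers. -/
theorem RandAlg.expect_mono {m : ℕ} (R : RandAlg m) {f g : List (Buyer m × Decision m) → ℝ}
    (P : List (Buyer m × Decision m) → Prop)
    (step : ∀ h b, ∀ D ∈ (R.decide h b).support, P h → P (h ++ [(b, D)])) (σ : List (Buyer m)) :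
    ∀ h, P h → (∀ h', P h' → h'.map Prod.fst = h.map Prod.fst ++ σ → f h' ≤ g h') →
      R.expect f h σ ≤ R.expect g h σ := by
  induction σ with
  | nil => intro h hP hfg; exact hfg h hP (by simp)
  | cons b σ ih =>
    intro h hP hfg
    refine Finset.sum_le_sum fun D _ => ?_
    by_cases hD : D ∈ (R.decide h b).support
    · refine mul_le_mul_of_nonneg_left (ih _ (step h b D hD hP) fun h' hP' hh' => ?_)
        ENNReal.toReal_nonneg
      exact hfg h' hP' (by simpa using hh')
    · rw [PMF.mem_support_iff, not_not] at hD
      simp [hD]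

theorem RandAlg.expect_add {m : ℕ} (R : RandAlg m) (f g : List (Buyer m × Decision m) → ℝ)
    (σ : List (Buyer m)) :
    ∀ h, R.expect (fun h' => f h' + g h') h σ = R.expect f h σ + R.expect g h σ := by
  induction σ with
  | nil => intro h; rfl
  | cons b σ ih => intro h; simp only [RandAlg.expect, ih, mul_add, Finset.sum_add_distrib]

theorem RandAlg.expect_const_mul {m : ℕ} (R : RandAlg m) (c : ℝ)
    (f : List (Buyer m × Decision m) → ℝ) (σ : List (Buyer m)) :
    ∀ h, R.expect (fun h' => c * f h') h σ = c * R.expect f h σ := by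
  induction σ with
  | nil => intro h; rfl
  | cons b σ ih =>
    intro h
    simp only [RandAlg.expect, ih, Finset.mul_sum]
    exact Finset.sum_congr rfl fun D _ => by ring

theorem RandAlg.expect_const {m : ℕ} (R : RandAlg m) (c : ℝ) (σ : List (Buyer m)) :
    ∀ h, R.expect (fun _ => c) h σ = c := by
  induction σ with
  | nil => intro h; rfl
  | cons b σ ih =>
    intro h
    simp only [RandAlg.expect, ih, ← Finset.sum_mul, PMF.sum_toReal_eq_one, one_mul]

theorem RandAlg.expect_sum {m : ℕ} {ι : Type*} (R : RandAlg m) (s : Finset ι)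
    (f : ι → List (Buyer m × Decision m) → ℝ) (σ : List (Buyer m))
    (h : List (Buyer m × Decision m)) :
    R.expect (fun h' => ∑ i ∈ s, f i h') h σ = ∑ i ∈ s, R.expect (f i) h σ := by
  classical
  induction s using Finset.induction_on with
  | empty => simpa using R.expect_const 0 σ h
  | insert i s hi ih => simp only [Finset.sum_insert hi, R.expect_add, ih]

/-! ### Completing a subprobability to a distribution -/

/-- The distribution that takes the value `some T` with probability `w T`. -/
noncomputable def PMF.ofSubprobability {γ : Type*} [Fintype γ] (w : γ → ℝ) (h0 : ∀ T, 0 ≤ w T)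
    (h1 : ∑ T, w T ≤ 1) : PMF (Option γ) :=
  PMF.ofFintype
    (fun D => D.elim (ENNReal.ofReal (1 - ∑ T, w T)) fun T => ENNReal.ofReal (w T)) <| by
    rw [Fintype.sum_option]
    simp only [Option.elim]
    rw [← ENNReal.ofReal_sum_of_nonneg fun T _ => h0 T,
      ← ENNReal.ofReal_add (sub_nonneg.2 h1) (Finset.sum_nonneg fun T _ => h0 T)]
    simp

/-- Eliminating the mass of `none` leaves an expression linear in the weights, which can be
estimated bundle by bundle. -/
theorem PMF.sum_ofSubprobability_mul {γ : Type*} [Fintype γ] (w : γ → ℝ) (h0 : ∀ T, 0 ≤ w T)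
    (h1 : ∑ T, w T ≤ 1) (F : Option γ → ℝ) :
    ∑ D, (PMF.ofSubprobability w h0 h1 D).toReal * F D =
      F none + ∑ T, w T * (F (some T) - F none) := by
  rw [Fintype.sum_option]
  simp only [PMF.ofSubprobability, PMF.ofFintype_apply, Option.elim,
    ENNReal.toReal_ofReal (sub_nonneg.2 h1), ENNReal.toReal_ofReal (h0 _), mul_sub,
    Finset.sum_sub_distrib, ← Finset.sum_mul]
  ring

/-! ### Fractional algorithms -/

theorem FracAlg.alloc_nonneg {m : ℕ} (A : FracAlg m) (σ : List (Buyer m)) (b : Buyer m) :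
    ∀ T ∈ b.bundles, 0 ≤ A.alloc σ b T := by
  -- The arriving buyer has index `σ.length` in `σ ++ [b]`.
  have := (A.feasible (σ ++ [b])).y_nonneg ⟨σ.length, by simp⟩
  simpa using this

theorem FracAlg.sum_alloc_le_one {m : ℕ} (A : FracAlg m) (σ : List (Buyer m)) (b : Buyer m) :
    ∑ T ∈ b.bundles, A.alloc σ b T ≤ 1 := by
  have := (A.feasible (σ ++ [b])).sum_le_one ⟨σ.length, by simp⟩
  simpa using this

/-- The fractional demand for item `j`. -/
noncomputable def FracAlg.fracDemand {m : ℕ} (A : FracAlg m) (σ : List (Buyer m)) (j : Fin m) :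
    ℝ :=
  ∑ i : Fin σ.length, ∑ T ∈ (σ.get i).bundles,
    if j ∈ T then A.alloc (σ.take i) (σ.get i) T else 0

/-- The total payment of the fractional solution. -/
noncomputable def FracAlg.fracValue {m : ℕ} (A : FracAlg m) (σ : List (Buyer m)) : ℝ :=
  ∑ i : Fin σ.length, ∑ T ∈ (σ.get i).bundles,
    (σ.get i).value T * A.alloc (σ.take i) (σ.get i) T

theorem FracAlg.fracDemand_append {m : ℕ} (A : FracAlg m) (σ : List (Buyer m)) (b : Buyer m)
    (j : Fin m) :
    A.fracDemand (σ ++ [b]) j =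
      A.fracDemand σ j + ∑ T ∈ b.bundles, if j ∈ T then A.alloc σ b T else 0 :=
  sum_take_get_append (fun τ (c : Buyer m) => ∑ T ∈ c.bundles, if j ∈ T then A.alloc τ c T else 0) σ b

theorem FracAlg.fracValue_append {m : ℕ} (A : FracAlg m) (σ : List (Buyer m)) (b : Buyer m) :
    A.fracValue (σ ++ [b]) =
      A.fracValue σ + ∑ T ∈ b.bundles, b.value T * A.alloc σ b T :=
  sum_take_get_append (fun τ (c : Buyer m) => ∑ T ∈ c.bundles, c.value T * A.alloc τ c T) σ b

/-! ### The rounding algorithm -/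

/-- The number of copies of item `j` that have been allocated. -/
noncomputable def totalDemand {m : ℕ} (h : List (Buyer m × Decision m)) (j : Fin m) : ℝ :=
  (h.map fun p => Decision.demand p.2 j).sum

/-- The total payment of the served buyers. -/
noncomputable def totalPayment {m : ℕ} (h : List (Buyer m × Decision m)) : ℝ :=
  (h.map fun p => p.1.payment p.2).sum

theorem Decision.demand_nonneg {m : ℕ} (D : Decision m) (j : Fin m) : 0 ≤ D.demand j := by
  cases D with
  | none => exact le_rfl
  | some T => simp only [Decision.demand, Option.elim]; split_ifs <;> norm_num

theorem totalDemand_nonneg {m : ℕ} (h : List (Buyer m × Decision m)) : 0 ≤ totalDemand h := by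
  intro j
  refine List.sum_nonneg fun x hx => ?_
  obtain ⟨p, -, rfl⟩ := List.mem_map.1 hx
  exact Decision.demand_nonneg _ _

theorem totalDemand_append {m : ℕ} (h : List (Buyer m × Decision m)) (b : Buyer m)
    (D : Decision m) (j : Fin m) :
    totalDemand (h ++ [(b, D)]) j = totalDemand h j + D.demand j := by
  simp [totalDemand]

theorem totalPayment_append {m : ℕ} (h : List (Buyer m × Decision m)) (b : Buyer m)
    (D : Decision m) : totalPayment (h ++ [(b, D)]) = totalPayment h + b.payment D := by
  simp [totalPayment]

open Classical in
/-- The probability with which bundle `T` is allocated: the fractional allocation scaled by `s`,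
provided that the resulting demand stays below the threshold `thr`. -/
noncomputable def FracAlg.roundWeight {m : ℕ} (A : FracAlg m) (s : ℝ)
    (thr : List (Buyer m) → Fin m → ℝ) (h : List (Buyer m × Decision m)) (b : Buyer m)
    (T : Finset (Fin m)) : ℝ :=
  if T ∈ b.bundles ∧
      ∀ j, totalDemand h j + Decision.demand (some T) j ≤ thr (h.map Prod.fst ++ [b]) j
    then s * A.alloc (h.map Prod.fst) b T else 0

section Round

variable {m : ℕ} (A : FracAlg m) {s : ℝ} (hs0 : 0 ≤ s) (hs1 : s ≤ 1)
  (thr : List (Buyer m) → Fin m → ℝ)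

theorem FracAlg.roundWeight_nonneg (hs0 : 0 ≤ s) (h : List (Buyer m × Decision m)) (b : Buyer m)
    (T : Finset (Fin m)) : 0 ≤ A.roundWeight s thr h b T := by
  rw [FracAlg.roundWeight]
  split_ifs with hT
  · exact mul_nonneg hs0 (A.alloc_nonneg _ _ _ hT.1)
  · exact le_rfl

theorem FracAlg.sum_roundWeight_mul_le (hs0 : 0 ≤ s) (h : List (Buyer m × Decision m))
    (b : Buyer m) (x : Finset (Fin m) → ℝ) (hx : ∀ T, 0 ≤ x T) :
    ∑ T, A.roundWeight s thr h b T * x T ≤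
      s * ∑ T ∈ b.bundles, A.alloc (h.map Prod.fst) b T * x T := by
  rw [Finset.mul_sum, ← Finset.sum_subset (Finset.subset_univ b.bundles)]
  · refine Finset.sum_le_sum fun T hT => ?_
    rw [← mul_assoc]
    refine mul_le_mul_of_nonneg_right ?_ (hx T)
    rw [FracAlg.roundWeight]
    split_ifs
    · exact le_rfl
    · exact mul_nonneg hs0 (A.alloc_nonneg _ _ _ hT)
  · intro T _ hT
    simp [FracAlg.roundWeight, hT]

theorem FracAlg.sum_roundWeight_le_one (hs0 : 0 ≤ s) (hs1 : s ≤ 1)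
    (h : List (Buyer m × Decision m)) (b : Buyer m) :
    ∑ T, A.roundWeight s thr h b T ≤ 1 := by
  have h1 := A.sum_roundWeight_mul_le thr hs0 h b (fun _ => 1) fun _ => zero_le_one
  simp only [mul_one] at h1
  exact h1.trans (mul_le_one₀ hs1 (Finset.sum_nonneg fun T hT => A.alloc_nonneg _ _ T hT)
    (A.sum_alloc_le_one _ _))

/-- Independent rounding of a fractional online algorithm, in which a buyer is skipped when
serving him would push the demand above the threshold. -/
noncomputable def FracAlg.round : RandAlg m where
  decide h b := PMF.ofSubprobability (A.roundWeight s thr h b) (A.roundWeight_nonneg thr hs0 h b)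
    (A.sum_roundWeight_le_one thr hs0 hs1 h b)
  admissible := by
    rintro h b D hD T rfl
    by_contra hT
    simp [PMF.ofSubprobability, FracAlg.roundWeight, hT] at hD

theorem FracAlg.sum_round_decide_mul (h : List (Buyer m × Decision m)) (b : Buyer m)
    (F : Decision m → ℝ) :
    ∑ D, ((A.round hs0 hs1 thr).decide h b D).toReal * F D =
      F none + ∑ T, A.roundWeight s thr h b T * (F (some T) - F none) :=
  PMF.sum_ofSubprobability_mul _ (A.roundWeight_nonneg thr hs0 h b)
    (A.sum_roundWeight_le_one thr hs0 hs1 h b) F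

/-- A bundle that breaks the threshold has weight zero; after a skip, monotonicity of `thr` keeps
the bound. -/
theorem FracAlg.totalDemand_le_step (hthr : ∀ σ b, thr σ ≤ thr (σ ++ [b]))
    (h : List (Buyer m × Decision m)) (b : Buyer m) :
    ∀ D ∈ ((A.round hs0 hs1 thr).decide h b).support,
      totalDemand h ≤ thr (h.map Prod.fst) →
        totalDemand (h ++ [(b, D)]) ≤ thr ((h ++ [(b, D)]).map Prod.fst) := by
  intro D hD hle j
  rw [totalDemand_append, List.map_append, List.map_singleton]
  cases D with
  | none => simpa [Decision.demand] using (hle j).trans (hthr _ _ j)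
  | some T =>
    by_contra hT
    have : ¬ ∀ j, totalDemand h j + Decision.demand (some T) j ≤
        thr (h.map Prod.fst ++ [b]) j := fun H => hT (H j)
    simp [FracAlg.round, PMF.ofSubprobability, FracAlg.roundWeight, this] at hD

/-- The moment generating function of the rounded demand. -/
theorem FracAlg.expect_exp_totalDemand_le {t : ℝ} (ht : 0 ≤ t) (j : Fin m)
    (σ : List (Buyer m)) :
    (A.round hs0 hs1 thr).expect (fun h => Real.exp (t * totalDemand h j)) [] σ ≤
      Real.exp ((Real.exp t - 1) * (s * A.fracDemand σ j)) := by
  have het : 0 ≤ Real.exp t - 1 := sub_nonneg.2 (Real.one_le_exp ht)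
  induction σ using List.reverseRecOn with
  | nil => simp [RandAlg.expect, totalDemand, FracAlg.fracDemand]
  | append_singleton σ b ih =>
    set d : ℝ := ∑ T ∈ b.bundles, if j ∈ T then A.alloc σ b T else 0 with hd
    rw [RandAlg.expect_append, A.fracDemand_append, ← hd]
    calc _ ≤ (A.round hs0 hs1 thr).expect (fun h => Real.exp ((Real.exp t - 1) * (s * d)) *
            Real.exp (t * totalDemand h j)) [] σ := by
          refine RandAlg.expect_mono _ (fun _ => True) (fun _ _ _ _ _ => trivial) σ [] trivial ?_
          intro h _ hh
          rw [FracAlg.sum_round_decide_mul]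
          -- Whatever the history, item `j` is allocated with conditional probability at most `s *
          -- d`, and then the exponential grows by the factor `exp t`. The conditional growth is
          -- therefore at most `1 + (exp t - 1) * (s * d)`.
          have key : ∀ T : Finset (Fin m),
              Real.exp (t * totalDemand (h ++ [(b, some T)]) j) -
                Real.exp (t * totalDemand (h ++ [(b, none)]) j) =
              (Real.exp (t * totalDemand h j) * (Real.exp t - 1)) * (if j ∈ T then 1 else 0) := by
            intro T
            rw [totalDemand_append, totalDemand_append]
            simp only [Decision.demand, Option.elim, add_zero]
            split_ifs
            · rw [mul_add, mul_one, Real.exp_add]; ring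
            · simp
          have h1 := A.sum_roundWeight_mul_le thr hs0 h b (fun T => if j ∈ T then 1 else 0)
            fun T => by positivity
          have h2 : h.map Prod.fst = σ := by simpa using hh
          simp only [mul_ite, mul_one, mul_zero, h2, ← hd] at h1
          simp only [key]
          rw [totalDemand_append]
          simp only [Decision.demand, Option.elim, add_zero]
          have h3 : ∀ T : Finset (Fin m), A.roundWeight s thr h b T *
              (Real.exp (t * totalDemand h j) * (Real.exp t - 1) * (if j ∈ T then 1 else 0)) =
              Real.exp (t * totalDemand h j) * (Real.exp t - 1) *
                (if j ∈ T then A.roundWeight s thr h b T else 0) := by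
            intro T; split_ifs <;> ring
          rw [Finset.sum_congr rfl fun T _ => h3 T, ← Finset.mul_sum]
          calc _ ≤ Real.exp (t * totalDemand h j) +
                Real.exp (t * totalDemand h j) * (Real.exp t - 1) * (s * d) := by gcongr
            _ = ((Real.exp t - 1) * (s * d) + 1) * Real.exp (t * totalDemand h j) := by ring
            _ ≤ _ := by gcongr; exact Real.add_one_le_exp _
      _ ≤ Real.exp ((Real.exp t - 1) * (s * d)) *
            Real.exp ((Real.exp t - 1) * (s * A.fracDemand σ j)) := by
          rw [RandAlg.expect_const_mul]
          gcongr
      _ = _ := by rw [← Real.exp_add]; ring_nf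

/-- Each buyer is skipped by the rounding with probability at most `δ`. -/
theorem FracAlg.le_expect_totalPayment {t δ : ℝ} (ht : 0 ≤ t)
    (hδ : ∀ σ b, ∑ j, Real.exp (-(t * (thr (σ ++ [b]) j - 1))) *
      Real.exp ((Real.exp t - 1) * (s * A.fracDemand σ j)) ≤ δ)
    (σ : List (Buyer m)) :
    s * (1 - δ) * A.fracValue σ ≤ (A.round hs0 hs1 thr).expect totalPayment [] σ := by
  induction σ using List.reverseRecOn with
  | nil => simp [RandAlg.expect, totalPayment, FracAlg.fracValue]
  | append_singleton σ b ih =>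
    set R := A.round hs0 hs1 thr with hR
    set v : ℝ := ∑ T ∈ b.bundles, b.value T * A.alloc σ b T with hv
    have hv0 : 0 ≤ v := Finset.sum_nonneg fun T hT =>
      mul_nonneg (b.value_nonneg T hT) (A.alloc_nonneg _ _ T hT)
    rw [RandAlg.expect_append, A.fracValue_append, ← hv]
    -- The sum over `j` is an exponential upper bound for the indicator that some bundle is refused.
    -- The `- 1` in the exponent accounts for the arriving bundle, which adds at most one copy of
    -- each item.
    have hbound : R.expect (fun h => totalPayment h + (s * v + -(s * v) *
        ∑ j, Real.exp (-(t * (thr (σ ++ [b]) j - 1))) * Real.exp (t * totalDemand h j))) [] σ ≤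
        R.expect (fun h' => ∑ D, (R.decide h' b D).toReal * totalPayment (h' ++ [(b, D)]))
          [] σ := by
      refine RandAlg.expect_mono _ (fun _ => True) (fun _ _ _ _ _ => trivial) σ [] trivial ?_
      intro h _ hh
      have h2 : h.map Prod.fst = σ := by simpa using hh
      rw [hR, FracAlg.sum_round_decide_mul]
      simp only [totalPayment_append, Buyer.payment, Option.elim, add_zero, add_sub_cancel_left]
      refine add_le_add_right ?_ _
      set p := ∑ j, Real.exp (-(t * (thr (σ ++ [b]) j - 1))) * Real.exp (t * totalDemand h j)
        with hp
      have hp0 : 0 ≤ p := Finset.sum_nonneg fun j _ => by positivity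
      rw [← Finset.sum_subset (Finset.subset_univ b.bundles)
        (fun T _ hT => by simp [FracAlg.roundWeight, hT])]
      have : s * v + -(s * v) * p =
          ∑ T ∈ b.bundles, (s * A.alloc σ b T) * (1 - p) * b.value T := by
        rw [hv, show s * v + -(s * v) * p = s * (1 - p) * v by ring, hv, Finset.mul_sum]
        exact Finset.sum_congr rfl fun T _ => by ring
      rw [this]
      refine Finset.sum_le_sum fun T hT => ?_
      refine mul_le_mul_of_nonneg_right ?_ (b.value_nonneg T hT)
      have hw : 0 ≤ s * A.alloc σ b T := mul_nonneg hs0 (A.alloc_nonneg _ _ T hT)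
      rw [FracAlg.roundWeight, h2]
      -- If `T` fits, `p ≥ 0` suffices. If it is refused, `p ≥ 1` and the lower bound is
      -- nonpositive.
      split_ifs with hok
      · nlinarith
      · obtain ⟨j, hj⟩ : ∃ j, thr (σ ++ [b]) j < totalDemand h j + Decision.demand (some T) j := by
          by_contra! H
          exact hok ⟨hT, H⟩
        have hd1 : Decision.demand (some T) j ≤ 1 := by
          simp only [Decision.demand, Option.elim]; split_ifs <;> norm_num
        have h1p : 1 ≤ p := by
          refine le_trans ?_ (Finset.single_le_sum (f := fun j =>
            Real.exp (-(t * (thr (σ ++ [b]) j - 1))) * Real.exp (t * totalDemand h j))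
            (fun j _ => by positivity) (Finset.mem_univ j))
          rw [← Real.exp_add]
          refine Real.one_le_exp ?_
          nlinarith
        nlinarith
    refine le_trans ?_ hbound
    rw [R.expect_add, R.expect_add, R.expect_const, R.expect_const_mul, R.expect_sum]
    have hfail : ∑ j, R.expect (fun h => Real.exp (-(t * (thr (σ ++ [b]) j - 1))) *
        Real.exp (t * totalDemand h j)) [] σ ≤ δ := by
      refine le_trans (Finset.sum_le_sum fun j _ => ?_) (hδ σ b)
      rw [R.expect_const_mul]
      exact mul_le_mul_of_nonneg_left (A.expect_exp_totalDemand_le hs0 hs1 thr ht j σ)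
        (Real.exp_nonneg _)
    have := mul_le_mul_of_nonneg_left hfail (mul_nonneg hs0 hv0)
    linarith

/-- The production cost of the rounded solution is at most that of the threshold. -/
theorem FracAlg.le_expectedProfit_round {g : (Fin m → ℝ) → ℝ} (hg : MonotoneOn g (Ici 0))
    (hthr0 : 0 ≤ thr []) (hthr : ∀ σ b, thr σ ≤ thr (σ ++ [b])) (σ : List (Buyer m)) :
    (A.round hs0 hs1 thr).expect totalPayment [] σ - g (thr σ) ≤
      (A.round hs0 hs1 thr).expectedProfit g σ := by
  rw [RandAlg.expectedProfit, RandAlg.tsum_run, sub_eq_add_neg,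
    ← RandAlg.expect_const (A.round hs0 hs1 thr) (-g (thr σ)) σ [], ← RandAlg.expect_add]
  refine RandAlg.expect_mono _ (fun h => totalDemand h ≤ thr (h.map Prod.fst))
    (A.totalDemand_le_step hs0 hs1 thr hthr) σ [] ?_ ?_
  · intro j; simpa [totalDemand] using hthr0 j
  · intro h hle hh
    have h2 : h.map Prod.fst = σ := by simpa using hh
    rw [h2] at hle
    have h0 := totalDemand_nonneg h
    have := hg h0 (h0.trans hle) hle
    rw [_root_.profit, ← sub_eq_add_neg]
    exact sub_le_sub_left this _

end Round

/-! ### The offline optima -/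

/-- An integral allocation is a 0/1 point of the convex program whose production equals its demand.
-/
theorem profit_eq_fracProfit {m : ℕ} (g : (Fin m → ℝ) → ℝ) (h : List (Buyer m × Decision m))
    (hadm : ∀ p ∈ h, p.1.Admissible p.2) :
    ∃ y μ, FracFeasible (h.map Prod.fst) y μ ∧
      profit g h = fracProfit g (h.map Prod.fst) y μ := by
  have hlen : (h.map Prod.fst).length = h.length := by simp
  set y : Fin (h.map Prod.fst).length → Finset (Fin m) → ℝ :=
    fun i T => if (h.get (i.cast hlen)).2 = some T then 1 else 0 with hy
  have hone : ∀ (x : Buyer m → Finset (Fin m) → ℝ) (b : Buyer m) (D : Decision m),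
      b.Admissible D → ∑ T ∈ b.bundles, x b T * (if D = some T then 1 else 0) =
        D.elim 0 (x b) := by
    intro x b D hD
    cases D with
    | none => simp
    | some T => simp [hD T rfl]
  have hsum : ∀ (x : Buyer m → Finset (Fin m) → ℝ),
      ∑ i, ∑ T ∈ ((h.map Prod.fst).get i).bundles, x ((h.map Prod.fst).get i) T * y i T =
        (h.map fun p => p.2.elim 0 (x p.1)).sum := by
    intro x
    rw [← (finCongr hlen.symm).sum_comp, ← Fin.sum_univ_fun_getElem h]
    refine Finset.sum_congr rfl fun i _ => ?_
    simp only [hy, finCongr_apply, List.get_eq_getElem, List.getElem_map, Fin.val_cast]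
    exact hone x _ _ (hadm h[(i : ℕ)] (by simp))
  refine ⟨y, totalDemand h, ⟨?_, totalDemand_nonneg h, ?_, ?_⟩, ?_⟩
  · intro i T _
    simp only [hy]; positivity
  · intro i
    simp only [hy]
    generalize (h.get (i.cast hlen)).2 = D
    cases D with
    | none => simp
    | some T =>
      simp only [Option.some.injEq, Finset.sum_ite_eq]
      split_ifs <;> norm_num
  · intro j
    have := hsum fun _ T => if j ∈ T then 1 else 0
    simp only [ite_mul, one_mul, zero_mul] at this
    exact this.le
  · rw [fracProfit, hsum]
    rfl

/-- Boundedness matters because the real `sSup` of an unbounded set is `0`. -/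
theorem bddAbove_fracProfit {m : ℕ} {g : (Fin m → ℝ) → ℝ} (hg : ∀ μ, 0 ≤ μ → 0 ≤ g μ)
    (σ : List (Buyer m)) :
    BddAbove {r | ∃ y μ, FracFeasible σ y μ ∧ r = fracProfit g σ y μ} := by
  refine ⟨∑ i, ∑ T ∈ (σ.get i).bundles, (σ.get i).value T, ?_⟩
  rintro r ⟨y, μ, hf, rfl⟩
  refine (sub_le_self _ (hg μ hf.μ_nonneg)).trans ?_
  refine Finset.sum_le_sum fun i _ => Finset.sum_le_sum fun T hT => ?_
  refine mul_le_of_le_one_right ((σ.get i).value_nonneg T hT) ?_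
  exact (Finset.single_le_sum (fun T hT => hf.y_nonneg i T hT) hT).trans (hf.sum_le_one i)

theorem profit_le_offlineFracOpt {m : ℕ} {g : (Fin m → ℝ) → ℝ} (hg : ∀ μ, 0 ≤ μ → 0 ≤ g μ)
    {h : List (Buyer m × Decision m)} (hadm : ∀ p ∈ h, p.1.Admissible p.2) :
    profit g h ≤ offlineFracOpt g (h.map Prod.fst) := by
  obtain ⟨y, μ, hf, hp⟩ := profit_eq_fracProfit g h hadm
  exact le_csSup (bddAbove_fracProfit hg _) ⟨y, μ, hf, hp⟩

theorem offlineOpt_nonneg {m : ℕ} {g : (Fin m → ℝ) → ℝ} (hg : ∀ μ, 0 ≤ μ → 0 ≤ g μ)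
    (hg0 : g 0 = 0) (σ : List (Buyer m)) : 0 ≤ offlineOpt g σ := by
  refine le_csSup ⟨offlineFracOpt g σ, ?_⟩ ⟨σ.map fun b => (b, none), ?_, ?_, ?_⟩
  · rintro r ⟨h, rfl, hadm, rfl⟩
    exact profit_le_offlineFracOpt hg hadm
  · simp [Function.comp_def]
  · simp [Buyer.Admissible]
  · have : (fun _ : Fin m => (0 : ℝ)) = 0 := rfl
    simp [profit, Function.comp_def, Buyer.payment, Decision.demand, this, hg0]

theorem offlineOpt_le_offlineFracOpt {m : ℕ} {g : (Fin m → ℝ) → ℝ} (hg : ∀ μ, 0 ≤ μ → 0 ≤ g μ)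
    (σ : List (Buyer m)) : offlineOpt g σ ≤ offlineFracOpt g σ := by
  refine csSup_le ⟨_, σ.map fun b => (b, none), ?_, ?_, rfl⟩ ?_
  · simp [Function.comp_def]
  · simp [Buyer.Admissible]
  · rintro r ⟨h, rfl, hadm, rfl⟩
    exact profit_le_offlineFracOpt hg hadm

theorem ScalesWith.map_zero {m : ℕ} {g : (Fin m → ℝ) → ℝ} {β : ℝ} (h : ScalesWith g β)
    (hβ : 1 < β) (h0 : 0 ≤ g 0) : g 0 = 0 := by
  have h1 := h (1 / 2) (by norm_num) (by norm_num) 0 le_rfl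
  rw [smul_zero] at h1
  have h2 : (1 / 2 : ℝ) ^ β < 1 := Real.rpow_lt_one (by norm_num) (by norm_num) (by linarith)
  nlinarith

/-! ### The choice of the parameters -/

/-- The union bound over the items for the failure probability of the rounding. -/
theorem failure_le {m : ℕ} (hm : 2 ≤ m) {ε a : ℝ} (hε0 : 0 < ε) (hε1 : ε < 1)
    (ha : a = max (1 / (m : ℝ)) (ε / (1 + ε))) :
    m * Real.exp (-(ε * (a * (12 * Real.log m / ε ^ 2) - 1))) ≤
      min (1 / (m : ℝ)) (ε / (1 + ε)) := by
  have hm2 : (2 : ℝ) ≤ m := by exact_mod_cast hm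
  have hm0 : (0 : ℝ) < m := by linarith
  set l := Real.log m with hl
  have hl1 : 1 / 2 ≤ l := by
    have := Real.log_le_log two_pos hm2
    have := Real.log_two_gt_d9
    linarith
  -- The exponent becomes `12 u l - ε`. The bound `u ≥ 1/2` comes from `a ≥ ε/(1+ε)`. The bound `u ≥
  -- 1/(m ε)` comes from `a ≥ 1/m` and serves when `ε` is far smaller than `1/m`.
  set u := a / ε with hu
  have hau : a = u * ε := by rw [hu]; field_simp
  have hu1 : 1 / 2 ≤ u := by
    rw [hu, le_div_iff₀ hε0]
    refine le_trans ?_ (ha ▸ le_max_right _ _)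
    rw [le_div_iff₀ (by linarith)]
    nlinarith
  have hum : 1 / (m * ε) ≤ u := by
    rw [hu, ← div_div]
    exact div_le_div_of_nonneg_right (ha ▸ le_max_left _ _) hε0.le
  have hexp : ε * (a * (12 * l / ε ^ 2) - 1) = 12 * (u * l) - ε := by
    rw [hau]; field_simp
  rw [hexp]
  have hml : (m : ℝ) = Real.exp l := (Real.exp_log hm0).symm
  have hul : u * l ≥ 1 / 2 * l := by gcongr
  have hul2 : u * l ≥ u * (1 / 2) := by gcongr
  refine le_min ?_ ?_
  · rw [one_div, hml, ← Real.exp_neg, ← Real.exp_add]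
    exact Real.exp_le_exp.2 (by linarith)
  · have h1 : ε / 2 ≤ ε / (1 + ε) := div_le_div_of_nonneg_left hε0.le (by linarith) (by linarith)
    refine le_trans ?_ h1
    have h2 : 2 / ε ≤ m * Real.exp (2 * u) := by
      have : 2 / ε = m * (2 * (1 / (m * ε))) := by field_simp
      rw [this]
      gcongr
      have := Real.add_one_le_exp (2 * u)
      linarith
    -- The constant 12 splits as 4 + 4 + 4: each of `2 l`, `2 u` and `ε` is at most `4 u l`.
    have h3 : m * Real.exp (-(12 * (u * l) - ε)) * (m * Real.exp (2 * u)) ≤ 1 := by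
      rw [hml, ← Real.exp_add, ← Real.exp_add, ← Real.exp_add]
      exact Real.exp_le_one_iff.2 (by linarith)
    have h4 : m * Real.exp (-(12 * (u * l) - ε)) * (2 / ε) ≤ 1 :=
      (mul_le_mul_of_nonneg_left h2 (by positivity)).trans h3
    rw [mul_div_assoc', div_le_one hε0] at h4
    linarith

/-- The expected profit of the rounding, in terms of the fractional solution. -/
theorem FracAlg.exists_round_profit {m : ℕ} (hm : 1 ≤ m) {g : (Fin m → ℝ) → ℝ}
    (hg : IsProductionCost g) {β : ℝ} (hβ : 1 < β) (hsc : ScalesWith g β) {ε : ℝ} (hε0 : 0 < ε)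
    (hε1 : ε < 1) (A : FracAlg m) :
    ∃ R : RandAlg m, ∀ σ,
      (1 + ε) ^ (-2 - 2 / (β - 1)) * (1 - 1 / (m : ℝ)) * A.profit g σ
        - g (fun _ => 12 * Real.log m / ε ^ 2) ≤ R.expectedProfit g σ := by
  have hm1 : (1 : ℝ) ≤ m := by exact_mod_cast hm
  have hm0 : (0 : ℝ) < m := by linarith
  have hβ1 : 0 < β - 1 := by linarith
  have h1ε : 0 < 1 + ε := by linarith
  set L := 12 * Real.log m / ε ^ 2 with hL
  have hL0 : 0 ≤ L := by have := Real.log_nonneg hm1; positivity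
  set κ := (1 + ε) ^ (-2 - 2 / (β - 1)) with hκ
  have hκ0 : 0 < κ := Real.rpow_pos_of_pos h1ε _
  -- Besides `c ^ β = κ`, also `c = κ (1+ε)^2`: one factor `1+ε` goes into `s`, the other is the
  -- slack in the threshold.
  set c := (1 + ε) ^ (-2 / (β - 1)) with hc
  have hc0 : 0 < c := Real.rpow_pos_of_pos h1ε _
  have hc1 : c < 1 := Real.rpow_lt_one_of_one_lt_of_neg (by linarith)
    (div_neg_of_neg_of_pos (by norm_num) hβ1)
  have hcβ : c ^ β = κ := by
    rw [hc, hκ, ← Real.rpow_mul h1ε.le]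
    congr 1
    field_simp
    ring
  have hcκ : κ * (1 + ε) = c / (1 + ε) := by
    have : c = κ * (1 + ε) ^ (2 : ℝ) := by
      rw [hc, hκ, ← Real.rpow_add h1ε]
      congr 1
      ring
    rw [this, Real.rpow_two]
    field_simp
  set b := ε / (1 + ε) with hb
  have hb0 : 0 < b := by positivity
  have hb1 : b < 1 := by rw [hb, div_lt_one h1ε]; linarith
  have hb' : 1 - b = 1 / (1 + ε) := by rw [hb]; field_simp; ring
  have him : 1 / (m : ℝ) ≤ 1 := by rw [div_le_one hm0]; exact hm1
  -- `1/m` and `b` are the two losses the target allows: the larger is spent on the weight of `L`,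
  -- the smaller on the skipping probability.
  set a := max (1 / (m : ℝ)) b with ha
  have ha0 : 0 < a := lt_max_of_lt_right hb0
  have ha1 : a ≤ 1 := max_le him hb1.le
  set s := (1 - a) * (κ * (1 + ε)) with hs
  have hs0 : 0 ≤ s := mul_nonneg (by linarith) (by positivity)
  have hs1 : s ≤ 1 := by
    refine mul_le_one₀ (by linarith) (by positivity) ?_
    rw [hcκ, div_le_one h1ε]
    linarith
  set thr : List (Buyer m) → Fin m → ℝ := fun σ j => (1 + ε) * (s * A.prod σ j) + a * L with hthr
  set δ := m * Real.exp (-(ε * (a * L - 1))) with hδ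
  refine ⟨A.round hs0 hs1 thr, fun σ => ?_⟩
  have hμ : 0 ≤ A.prod σ := (A.feasible σ).μ_nonneg
  have hmono : ∀ σ b, thr σ ≤ thr (σ ++ [b]) := fun σ b j => by
    have := A.prod_mono σ b j
    simp only [hthr]
    gcongr
  have hthr0 : 0 ≤ thr [] := fun j => by
    have := (A.feasible []).μ_nonneg j
    simp only [Pi.zero_apply] at this
    simp only [hthr, Pi.zero_apply]
    positivity
  have hpay := A.le_expect_totalPayment hs0 hs1 thr (t := ε) (δ := δ) hε0.le (fun σ b => by
    have : δ = ∑ _j : Fin m, Real.exp (-(ε * (a * L - 1))) := by simp [hδ]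
    rw [this]
    refine Finset.sum_le_sum fun j _ => ?_
    rw [← Real.exp_add]
    refine Real.exp_le_exp.2 ?_
    have hd : A.fracDemand σ j ≤ A.prod (σ ++ [b]) j :=
      ((A.feasible σ).demand_le j).trans (A.prod_mono σ b j)
    have hp0 : 0 ≤ A.prod (σ ++ [b]) j := (A.feasible _).μ_nonneg j
    -- With this bound the `μ` part of the threshold absorbs the moment generating function, leaving
    -- `exp (-(ε * (a * L - 1)))` for each item.
    have he : Real.exp ε - 1 ≤ ε * (1 + ε) := by
      have := (abs_le.1 (Real.abs_exp_sub_one_sub_id_le (x := ε)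
        (by rw [abs_of_pos hε0]; exact hε1.le))).2
      nlinarith
    have he0 : 0 ≤ Real.exp ε - 1 := sub_nonneg.2 (Real.one_le_exp hε0.le)
    have : (Real.exp ε - 1) * (s * A.fracDemand σ j) ≤
        ε * (1 + ε) * (s * A.prod (σ ++ [b]) j) :=
      (mul_le_mul_of_nonneg_left (mul_le_mul_of_nonneg_left hd hs0) he0).trans
        (mul_le_mul_of_nonneg_right he (mul_nonneg hs0 hp0))
    simp only [hthr]
    nlinarith) σ
  have hprofit := A.le_expectedProfit_round hs0 hs1 thr hg.mono hthr0 hmono σ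
  have hLmem : (fun _ : Fin m => L) ∈ Ici (0 : Fin m → ℝ) := fun _ => hL0
  have hgL := hg.nonneg _ hLmem
  have hgμ := hg.nonneg _ hμ
  have hcost : g (thr σ) ≤ (1 - a) * (κ * g (A.prod σ)) + a * g (fun _ => L) := by
    have e : thr σ = (1 - a) • (c • A.prod σ) + a • (fun _ => L) := by
      ext j
      have : (1 + ε) * (κ * (1 + ε)) = c := by rw [hcκ]; field_simp
      simp only [hthr, hs, Pi.add_apply, Pi.smul_apply, smul_eq_mul, ← this]
      ring
    rw [e]
    have hcμ : c • A.prod σ ∈ Ici (0 : Fin m → ℝ) := smul_nonneg hc0.le hμ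
    refine (hg.convex.2 hcμ hLmem (by linarith) ha0.le (by ring)).trans ?_
    simp only [smul_eq_mul]
    have := hsc c hc0 hc1 _ hμ
    rw [hcβ] at this
    have h1a : 0 ≤ 1 - a := by linarith
    gcongr
  have hV : A.profit g σ = A.fracValue σ - g (A.prod σ) := rfl
  have hV0 : 0 ≤ A.fracValue σ := Finset.sum_nonneg fun i _ => Finset.sum_nonneg fun T hT =>
    mul_nonneg ((σ.get i).value_nonneg T hT) (A.alloc_nonneg _ _ T hT)
  set V := A.fracValue σ
  set G := g (A.prod σ)
  -- `1 - a` and `q` are the two numbers `1 - 1/m` and `1/(1+ε)`, in increasing order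
  set q := 1 - min (1 / (m : ℝ)) b with hq
  have hpq : (1 - a) * q = (1 - 1 / (m : ℝ)) * (1 - b) := by
    rcases le_total (1 / (m : ℝ)) b with h | h
    · rw [ha, hq, max_eq_right h, min_eq_left h]; ring
    · rw [ha, hq, max_eq_left h, min_eq_right h]
  have hqb : 1 - b ≤ q := by rw [hq]; linarith [min_le_right (1 / (m : ℝ)) b]
  have hsq : s * q ≤ s * (1 - δ) := by
    -- For `m = 1` one has `log m = 0` and `failure_le` does not apply, but then `a = 1` and `s =
    -- 0`: nothing is sold.
    rcases hm.eq_or_lt with rfl | h2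
    · have : s = 0 := by
        rw [hs, ha, Nat.cast_one, div_one, max_eq_left hb1.le, sub_self, zero_mul]
      simp [this]
    · have := failure_le h2 hε0 hε1 ha
      refine mul_le_mul_of_nonneg_left ?_ hs0
      rw [hq]
      linarith
  have hsqV : s * q = κ * (1 - 1 / (m : ℝ)) := by
    rw [hs, mul_right_comm, hpq, hb']
    field_simp
  have h1 : κ * (1 - 1 / (m : ℝ)) * V ≤ s * (1 - δ) * V :=
    mul_le_mul_of_nonneg_right (hsqV ▸ hsq) hV0
  have h2 : (1 - a) * (κ * G) ≤ κ * (1 - 1 / (m : ℝ)) * G := by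
    have : (1 - a) * (κ * (1 + ε)) * (1 - b) ≤ s * q := mul_le_mul_of_nonneg_left hqb hs0
    rw [hsqV, hb'] at this
    have h3 : (1 - a) * κ ≤ κ * (1 - 1 / (m : ℝ)) := by
      refine le_trans (le_of_eq ?_) this
      field_simp
    calc (1 - a) * (κ * G) = (1 - a) * κ * G := by ring
      _ ≤ _ := mul_le_mul_of_nonneg_right h3 hgμ
  have h3 : a * g (fun _ => L) ≤ g (fun _ => L) := mul_le_of_le_one_left hgL ha1
  rw [hV, mul_sub]
  linarith

theorem mainTheorem10 :
    ∃ C : ℝ, 0 < C ∧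
      ∀ (m : ℕ), 1 ≤ m →
      ∀ (g : (Fin m → ℝ) → ℝ), IsProductionCost g → HasMonotoneGradientConj g →
      ∀ (β : ℝ), 1 < β → ScalesWith g β →
      ∀ (ε : ℝ), 0 < ε → ε < 1 →
      ∀ (A : FracAlg m),
        ∃ R : RandAlg m,
          ∀ (I : Set (List (Buyer m))) (α : ℝ), 0 < α → A.IsCompetitive g I α →
          ∀ σ ∈ I,
            (1 + ε) ^ (-2 - 2 / (β - 1)) * (offlineOpt g σ / α)
                - offlineOpt g σ / (m * α)
                - g (fun _ => C * Real.log m / ε ^ 2)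
              ≤ R.expectedProfit g σ ∧
            (1 + ε) ^ (-2 - 2 / (β - 1)) * (offlineFracOpt g σ / α)
                - offlineFracOpt g σ / (m * α)
                - g (fun _ => C * Real.log m / ε ^ 2)
              ≤ R.expectedProfit g σ := by

  refine ⟨12, by norm_num, fun m hm g hg _ β hβ hsc ε hε0 hε1 A => ?_⟩
  obtain ⟨R, hR⟩ := A.exists_round_profit hm hg hβ hsc hε0 hε1
  refine ⟨R, fun I α hα hA σ hσ => ?_⟩
  have hg0 : g 0 = 0 := hsc.map_zero hβ (hg.nonneg 0 le_rfl)
  have hopt := offlineOpt_nonneg hg.nonneg hg0 σ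
  have hle := offlineOpt_le_offlineFracOpt hg.nonneg σ
  have hm0 : (0 : ℝ) < m := by exact_mod_cast hm
  have him : 1 / (m : ℝ) ≤ 1 := by rw [div_le_one hm0]; exact_mod_cast hm
  set κ := (1 + ε) ^ (-2 - 2 / (β - 1)) with hκ
  have hκ0 : 0 < κ := Real.rpow_pos_of_pos (by linarith) _
  have hκ1 : κ ≤ 1 := by
    refine Real.rpow_le_one_of_one_le_of_nonpos (by linarith) ?_
    have : 0 < 2 / (β - 1) := div_pos two_pos (by linarith)
    linarith
  have key : ∀ x, 0 ≤ x → x ≤ offlineFracOpt g σ →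
      κ * (x / α) - x / (m * α) - g (fun _ => 12 * Real.log m / ε ^ 2) ≤
        R.expectedProfit g σ := by
    intro x hx0 hx
    refine le_trans (sub_le_sub_right ?_ _) (hR σ)
    have h1 : x / α ≤ A.profit g σ := (div_le_div_of_nonneg_right hx hα.le).trans (hA σ hσ)
    have h2 : 0 ≤ x / α := div_nonneg hx0 hα.le
    calc κ * (x / α) - x / (m * α) = (κ - 1 / (m : ℝ)) * (x / α) := by field_simp
      -- Since `κ ≤ 1`, the loss `κ / m` is at most `1 / m`.
      _ ≤ κ * (1 - 1 / (m : ℝ)) * (x / α) := by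
        refine mul_le_mul_of_nonneg_right ?_ h2
        have : 0 ≤ 1 / (m : ℝ) := by positivity
        nlinarith
      _ ≤ _ := mul_le_mul_of_nonneg_left h1 (mul_nonneg hκ0.le (by linarith))
  exact ⟨key _ hopt hle, key _ (hopt.trans hle) le_rfl⟩
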